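/- A sequence of positive integers $n_1<\dots<n_k$ with $\gcd(n_1,\dots,n_k)=1$ is called telescopic if, with $d_i=\gcd(n_1,\dots,n_i)$, for every $i=2,\dots,k$ the number $n_i/d_i$ belongs to the semigroup $\langle n_1/d_{i-1},\dots,n_{i-1}/d_{i-1}\rangle$. For such a sequence let $r_i=\frac{d_{i-1}}{d_i}\,n_i$ $(2\le i\le k)$. For a semigroup $U=\langle u_1,\dots,u_p\rangle\subseteq\mathbb N$ given by generators and a field $K$, let $K[U]=K[t^{u_1},\dots,t^{u_p}]$, regarded as a graded module over $A=K[X_1,\dots,X_p]$, $\deg X_l=u_l$, via $X_l\mapsto t^{u_l}$, and let $\beta_{i,j}(K[U])=\dim_K \mathrm{Tor}_i^A(K[U],K)_j$, where $\mathrm{Tor}$ is computed as the homology of the Koszul complex on $X_1,\dots,X_p$ tensored with $K[U]$. **Proposition.** Let $K$ be a field, let $(n_1,\dots,n_k)$ be a telescopic sequence, let $S=\langle n_1,\dots,n_k\rangle$, let $g(S)=\max(\mathbb Z\setminus S)$ be its Frobenius number, and let $f\ge 3g(S)+1$ be an odd integer. Put $T_1=\langle 2n_1,\dots,2n_k,\,f-2g(S)\rangle$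 and $T_2=\langle 2n_1,\dots,2n_k,\,f+2-2g(S)\rangle$, with Betti numbers taken with respect to these generators. Then for every $j\in\mathbb N$: 1. if $j\notin\{2(f-2g(S)),\,2(f-2g(S))+4\}$, then $\beta_{1,j}(K[T_2])=\beta_{1,j}(K[T_1])$; 2. if $j=2(f-2g(S))$, then $\beta_{1,j}(K[T_2])=\beta_{1,j}(K[T_1])-1$, and this number is $0$ if and only if $f-2g(S)\notin\{r_2,\dots,r_k\}$; 3. if $j=2(f-2g(S))+4$, then $\beta_{1,j}(K[T_2])=\beta_{1,j}(K[T_1])+1$. -/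

import Mathlib

open Polynomial

namespace NumSemigroup

/-- The semigroup `⟨n_1, …, n_k⟩` generated by a finite sequence of natural numbers. -/
def semigroup {k : ℕ} (n : Fin k → ℕ) : AddSubmonoid ℕ :=
  AddSubmonoid.closure (Set.range n)

/-- `g` is the Frobenius number of `S`, the largest integer that is not in `S`
(it equals `-1` for `S = ℕ`). -/
def IsFrobeniusNumber (S : AddSubmonoid ℕ) (g : ℤ) : Prop :=
  IsGreatest {x : ℤ | ∀ s ∈ S, (s : ℤ) ≠ x} g

/-- The gcd of the entries up to and including the one with index `i`. -/
def gcdUpTo {k : ℕ} (n : Fin k → ℕ) (i : Fin k) : ℕ := (Finset.Iic i).gcd n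

/-- The gcd of the entries strictly before the one with index `i`. -/
def gcdBefore {k : ℕ} (n : Fin k → ℕ) (i : Fin k) : ℕ := (Finset.Iio i).gcd n

/-- A telescopic sequence: a strictly increasing sequence `n_1 < … < n_k` of positive integers
with gcd `1` such that, with `d_i = gcd (n_1, …, n_i)`, for every `i ≥ 2` the number `n_i / d_i`
lies in the semigroup generated by `n_1 / d_{i-1}, …, n_{i-1} / d_{i-1}`. -/
structure IsTelescopic {k : ℕ} (n : Fin k → ℕ) : Prop where
  pos : ∀ i, 0 < n i
  strictMono : StrictMono n
  gcd_eq_one : Finset.univ.gcd n = 1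
  mem : ∀ i : Fin k, 0 < i.val →
    n i / gcdUpTo n i ∈
      AddSubmonoid.closure ((fun j => n j / gcdBefore n i) '' Set.Iio i)

/-- The number `(d_{i-1} / d_i) * n_i`, meant for `i ≥ 2`. -/
def relationDegree {k : ℕ} (n : Fin k → ℕ) (i : Fin k) : ℕ :=
  gcdBefore n i / gcdUpTo n i * n i

/-- The generators `2 n_1, …, 2 n_k, m`. -/
def doubleWith {k : ℕ} (n : Fin k → ℕ) (m : ℕ) : Fin (k + 1) → ℕ :=
  Fin.snoc (α := fun _ => ℕ) (fun i => 2 * n i) m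

section Koszul

variable (K : Type*) [Field K] {R : Type*} [CommRing R] [Algebra K R] {k : ℕ}

/-- The differential of the Koszul complex of a sequence `x_1, …, x_k` in `R`. An element `ω` of
the complex is written in the basis `e_I = e_{i_1} ∧ ⋯ ∧ e_{i_p}`, `I = {i_1 < ⋯ < i_p}`, and
`∂ e_I = ∑_q (-1)^(q-1) x_{i_q} e_{I \ {i_q}}`. -/
def koszulD (x : Fin k → R) : (Finset (Fin k) → R) →ₗ[K] (Finset (Fin k) → R) where
  toFun ω J := ∑ l ∈ Jᶜ, (-1) ^ (J.filter (· < l)).card * x l * ω (insert l J)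
  map_add' ω η := by
    funext J
    simp only [Pi.add_apply, mul_add, Finset.sum_add_distrib]
  map_smul' c ω := by
    funext J
    simp only [Pi.smul_apply, mul_smul_comm, Finset.smul_sum, RingHom.id_apply]

variable {K}

/-- The part of homological degree `i` and internal degree `s` of the Koszul complex, when `P a` is
the component of degree `a` of `R` and `x_l` has degree `w l`: the coefficient of `e_I` is
homogeneous of degree `s - ∑_{l ∈ I} w l`, and it is zero unless `I` has `i` elements. -/
def koszulPiece (P : ℕ → Submodule K R) (w : Fin k → ℕ) (i s : ℕ) :
    Submodule K (Finset (Fin k) → R) :=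
  Submodule.pi Set.univ fun I =>
    if I.card = i ∧ ∑ l ∈ I, w l ≤ s then P (s - ∑ l ∈ I, w l) else ⊥

/-- Koszul cycles of homological degree `i` and internal degree `s`. -/
def koszulCycles (P : ℕ → Submodule K R) (w : Fin k → ℕ) (x : Fin k → R) (i s : ℕ) :
    Submodule K (Finset (Fin k) → R) :=
  koszulPiece P w i s ⊓ LinearMap.ker (koszulD K x)

/-- Koszul boundaries of homological degree `i` and internal degree `s`. -/
def koszulBoundaries (P : ℕ → Submodule K R) (w : Fin k → ℕ) (x : Fin k → R) (i s : ℕ) :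
    Submodule K (Finset (Fin k) → R) :=
  (koszulPiece P w (i + 1) s).map (koszulD K x)

/-- The dimension over `K` of the part of internal degree `s` of the `i`-th Koszul homology. -/
noncomputable def koszulHomologyDim (P : ℕ → Submodule K R) (w : Fin k → ℕ) (x : Fin k → R)
    (i s : ℕ) : ℕ :=
  Module.finrank K
    (koszulCycles P w x i s ⧸ (koszulBoundaries P w x i s).submoduleOf (koszulCycles P w x i s))

end Koszul

section Betti

variable (K : Type*) [Field K] {k : ℕ} (n : Fin k → ℕ)

/-- The semigroup ring `K[t^{n_1}, …, t^{n_k}] ⊆ K[t]`. -/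
noncomputable def semigroupRing : Subalgebra K K[X] :=
  Algebra.adjoin K (Set.range fun i => (X : K[X]) ^ n i)

/-- The element `t^{n_i}` of the semigroup ring, the image of the variable `X_i`. -/
noncomputable def ringGen (i : Fin k) : semigroupRing K n :=
  ⟨X ^ n i, Algebra.subset_adjoin ⟨i, rfl⟩⟩

/-- The homogeneous component of degree `a` of the semigroup ring. -/
noncomputable def ringPiece (a : ℕ) : Submodule K (semigroupRing K n) :=
  (LinearMap.range (monomial a : K →ₗ[K] K[X])).comap (semigroupRing K n).val.toLinearMap

/-- The graded Betti number `β_{i,s} = dim_K Tor_i^A(K[S], K)_s` of the semigroup ring `K[S]`,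
`S = ⟨n_1, …, n_k⟩`, over the polynomial ring `A = K[X_1, …, X_k]` with `deg X_l = n_l`, where
`Tor` is the homology of the Koszul complex on `X_1, …, X_k` tensored with `K[S]`. -/
noncomputable def betti (i s : ℕ) : ℕ :=
  koszulHomologyDim (ringPiece K n) n (ringGen K n) i s

end Betti

end NumSemigroup

/-! In internal degree `j` the Koszul complex, in homological degrees 0, 1 and 2, is carried by a
graph: generator `l` is a vertex when `j - n l` lies in the semigroup, and `l`, `l'` are joined when
`j - n l - n l'` does. Hence `β_{1,j}` is the dimension of the reduced zeroth homology of this graph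
(`betti_one_eq_finrank`): the number of components minus one when there is a vertex.

Adjoin to `n` a generator `y` of order `c` modulo the group of `n`, with `c * y` in the semigroup of
`n`. Each new element is uniquely `s + e * y` with `e < c`. If `e > 0`, then `y` is joined to every
other vertex. If `e = 0`, the old generators span the old graph, and `y` is a vertex only when `s -
c * y` is an old element; it is then isolated if `s = c * y`, and otherwise attached to a single old
component. So exactly one relation appears, in degree `c * y` (`IsGluing.betti_one`).

A telescopic sequence is an iterated gluing with relation degrees `r_i`; doubling it doubles these
degrees. An odd `m` in `S` is glued to `2S` with `c = 2`, adding the degree `2 * m`. Since `f - 2g >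
g`, this applies to `m = f - 2g` and to `m + 2`: the two Betti counts share all `2 * r_i` and differ
only in `2m` against `2m + 4`. -/

namespace NumSemigroup

/-! ### Homogeneous elements of the semigroup ring -/

/-- Every exponent of an element of `K[S]` lies in `S`. -/
theorem mem_semigroup_of_coeff_ne_zero {K : Type*} [Field K] {k : ℕ} {n : Fin k → ℕ} {p : K[X]}
    (hp : p ∈ semigroupRing K n) : ∀ a, p.coeff a ≠ 0 → a ∈ semigroup n := by
  induction hp using Algebra.adjoin_induction with
  | mem x hx =>
    obtain ⟨i, rfl⟩ := hx
    intro a ha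
    simp only [coeff_X_pow, ne_eq, ite_eq_right_iff, one_ne_zero, imp_false, not_not] at ha
    exact ha ▸ AddSubmonoid.subset_closure ⟨i, rfl⟩
  | algebraMap r =>
    intro a ha
    rw [Polynomial.algebraMap_apply, coeff_C] at ha
    have : a = 0 := by
      by_contra h
      exact ha (if_neg h)
    exact this ▸ zero_mem _
  | add x y _ _ hx hy =>
    intro a ha
    rw [coeff_add] at ha
    by_cases h : x.coeff a = 0
    · exact hy a (by simpa [h] using ha)
    · exact hx a h
  | mul x y _ _ hx hy =>
    intro a ha
    rw [coeff_mul] at ha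
    obtain ⟨⟨b, c⟩, hbc, h⟩ := Finset.exists_ne_zero_of_sum_ne_zero ha
    rw [← Finset.HasAntidiagonal.mem_antidiagonal.1 hbc]
    exact add_mem (hx b (left_ne_zero_of_mul h)) (hy c (right_ne_zero_of_mul h))

theorem X_pow_mem_semigroupRing (K : Type*) [Field K] {k : ℕ} {n : Fin k → ℕ} {a : ℕ}
    (ha : a ∈ semigroup n) : (X : K[X]) ^ a ∈ semigroupRing K n := by
  induction ha using AddSubmonoid.closure_induction with
  | mem x hx =>
    obtain ⟨i, rfl⟩ := hx
    exact Algebra.subset_adjoin ⟨i, rfl⟩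
  | zero => simp
  | add x y _ _ hx hy => rw [pow_add]; exact mul_mem hx hy

theorem monomial_mem_semigroupRing {K : Type*} [Field K] {k : ℕ} {n : Fin k → ℕ} {a : ℕ}
    (ha : a ∈ semigroup n) (c : K) : monomial a c ∈ semigroupRing K n := by
  rw [← C_mul_X_pow_eq_monomial, ← smul_eq_C_mul]
  exact Subalgebra.smul_mem _ (X_pow_mem_semigroupRing K ha) c

theorem mem_ringPiece {K : Type*} [Field K] {k : ℕ} {n : Fin k → ℕ} {a : ℕ}
    {r : semigroupRing K n} : r ∈ ringPiece K n a ↔ ∃ c : K, (r : K[X]) = monomial a c := by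
  simp only [ringPiece, Submodule.mem_comap, LinearMap.mem_range]
  exact ⟨fun ⟨c, h⟩ => ⟨c, h.symm⟩, fun ⟨c, h⟩ => ⟨c, h.symm⟩⟩

theorem eq_zero_or_mem_of_mem_ringPiece {K : Type*} [Field K] {k : ℕ} {n : Fin k → ℕ} {a : ℕ}
    {r : semigroupRing K n} (hr : r ∈ ringPiece K n a) : r = 0 ∨ a ∈ semigroup n := by
  obtain ⟨c, hc⟩ := mem_ringPiece.1 hr
  by_cases h : c = 0
  · left
    ext1
    simp [hc, h]
  · right
    apply mem_semigroup_of_coeff_ne_zero r.2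
    simpa [hc] using h

/-! ### First Koszul homology as reduced homology of a graph -/

/-- The vertices of the squarefree divisor complex of `j`. -/
def IsVertex {k : ℕ} (n : Fin k → ℕ) (j : ℕ) (l : Fin k) : Prop :=
  ∃ s ∈ semigroup n, s + n l = j

/-- The edges of the squarefree divisor complex of `j`. -/
def IsEdge {k : ℕ} (n : Fin k → ℕ) (j : ℕ) (l l' : Fin k) : Prop :=
  l ≠ l' ∧ ∃ s ∈ semigroup n, s + n l + n l' = j

theorem IsEdge.symm {k : ℕ} {n : Fin k → ℕ} {j : ℕ} {l l' : Fin k} (h : IsEdge n j l l') :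
    IsEdge n j l' l := by
  obtain ⟨hne, s, hs, h⟩ := h
  exact ⟨hne.symm, s, hs, by omega⟩

theorem IsEdge.left {k : ℕ} {n : Fin k → ℕ} {j : ℕ} {l l' : Fin k} (h : IsEdge n j l l') :
    IsVertex n j l := by
  obtain ⟨-, s, hs, h⟩ := h
  exact ⟨s + n l', add_mem hs (AddSubmonoid.subset_closure ⟨l', rfl⟩), by omega⟩

/-- The reduced simplicial `0`-cycles of the squarefree divisor complex of `j`. -/
def vertexCycles (K : Type*) [Field K] {k : ℕ} (n : Fin k → ℕ) (j : ℕ) :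
    Submodule K (Fin k → K) where
  carrier := {c | (∀ l, ¬ IsVertex n j l → c l = 0) ∧ ∑ l, c l = 0}
  zero_mem' := by simp
  add_mem' := by
    rintro a b ⟨ha, ha'⟩ ⟨hb, hb'⟩
    exact ⟨fun l hl => by simp [ha l hl, hb l hl], by simp [Finset.sum_add_distrib, ha', hb']⟩
  smul_mem' := by
    rintro c a ⟨ha, ha'⟩
    exact ⟨fun l hl => by simp [ha l hl], by simp [← Finset.mul_sum, ha']⟩

/-- The simplicial `0`-boundaries of the squarefree divisor complex of `j`. -/
def edgeBoundaries (K : Type*) [Field K] {k : ℕ} (n : Fin k → ℕ) (j : ℕ) :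
    Submodule K (Fin k → K) :=
  Submodule.span K {c | ∃ l l', IsEdge n j l l' ∧ c = Pi.single l 1 - Pi.single l' 1}

theorem single_sub_single_mem_edgeBoundaries (K : Type*) [Field K] {k : ℕ} {n : Fin k → ℕ} {j : ℕ}
    {l l' : Fin k} (h : IsEdge n j l l') :
    (Pi.single l 1 - Pi.single l' 1 : Fin k → K) ∈ edgeBoundaries K n j :=
  Submodule.subset_span ⟨l, l', h, rfl⟩

theorem edgeBoundaries_le_vertexCycles (K : Type*) [Field K] {k : ℕ} (n : Fin k → ℕ) (j : ℕ) :
    edgeBoundaries K n j ≤ vertexCycles K n j := by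
  refine Submodule.span_le.2 ?_
  rintro _ ⟨l, l', h, rfl⟩
  refine ⟨fun p hp => ?_, by simp⟩
  have h1 : p ≠ l := fun e => hp (e ▸ h.left)
  have h2 : p ≠ l' := fun e => hp (e ▸ h.symm.left)
  simp [h1, h2]

/-- The coefficients of the part of homological degree `1` of the Koszul complex. -/
def vertexCoeff (K : Type*) [Field K] {k : ℕ} (n : Fin k → ℕ) (j : ℕ) :
    (Finset (Fin k) → semigroupRing K n) →ₗ[K] (Fin k → K) where
  toFun ω l := (ω {l} : K[X]).coeff (j - n l)
  map_add' ω η := by funext l; simp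
  map_smul' c ω := by funext l; simp

theorem vertexCoeff_apply {K : Type*} [Field K] {k : ℕ} (n : Fin k → ℕ) (j : ℕ)
    (ω : Finset (Fin k) → semigroupRing K n) (l : Fin k) :
    vertexCoeff K n j ω l = (ω {l} : K[X]).coeff (j - n l) := rfl

theorem mem_koszulPiece {K : Type*} [Field K] {R : Type*} [CommRing R] [Algebra K R] {k : ℕ}
    {P : ℕ → Submodule K R} {w : Fin k → ℕ} {i s : ℕ} {ω : Finset (Fin k) → R} :
    ω ∈ koszulPiece P w i s ↔ ∀ I, (I.card = i ∧ ∑ l ∈ I, w l ≤ s ∧ ω I ∈ P (s - ∑ l ∈ I, w l)) ∨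
      ω I = 0 := by
  simp only [koszulPiece, Submodule.mem_pi, Set.mem_univ, forall_const]
  refine forall_congr' fun I => ?_
  split_ifs with h
  · exact ⟨fun hω => Or.inl ⟨h.1, h.2, hω⟩, fun hω => hω.elim (fun h => h.2.2)
      fun h0 => h0 ▸ zero_mem _⟩
  · rw [Submodule.mem_bot]
    exact ⟨Or.inr, fun hω => hω.elim (fun h' => absurd ⟨h'.1, h'.2.1⟩ h) id⟩

/-- The truncated subtraction in `vertexCoeff` is harmless: a nonzero entry forces `n l ≤ j`. -/
theorem vertex_of_mem_koszulPiece_one {K : Type*} [Field K] {k : ℕ} {n : Fin k → ℕ} {j : ℕ}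
    {ω : Finset (Fin k) → semigroupRing K n} (hω : ω ∈ koszulPiece (ringPiece K n) n 1 j)
    (l : Fin k) : ω {l} = 0 ∨
      (n l ≤ j ∧ IsVertex n j l ∧ (ω {l} : K[X]) = monomial (j - n l) (vertexCoeff K n j ω l)) := by
  rcases mem_koszulPiece.1 hω {l} with ⟨-, h1, h2⟩ | h
  · rw [Finset.sum_singleton] at h1 h2
    rcases eq_zero_or_mem_of_mem_ringPiece h2 with h | h
    · exact Or.inl h
    · refine Or.inr ⟨h1, ⟨_, h, by omega⟩, ?_⟩
      obtain ⟨c, hc⟩ := mem_ringPiece.1 h2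
      rw [vertexCoeff_apply, hc]
      simp
  · exact Or.inl h

theorem koszulD_empty_of_mem {K : Type*} [Field K] {k : ℕ} {n : Fin k → ℕ} {j : ℕ}
    {ω : Finset (Fin k) → semigroupRing K n} (hω : ω ∈ koszulPiece (ringPiece K n) n 1 j) :
    (koszulD K (ringGen K n) ω ∅ : K[X]) = monomial j (∑ l, vertexCoeff K n j ω l) := by
  simp only [koszulD, LinearMap.coe_mk, AddHom.coe_mk, Finset.compl_empty, Finset.filter_empty,
    Finset.card_empty, pow_zero, one_mul, map_sum, AddSubmonoidClass.coe_finsetSum]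
  refine Finset.sum_congr rfl fun l _ => ?_
  rcases vertex_of_mem_koszulPiece_one hω l with h | ⟨h1, -, h⟩
  · simp [vertexCoeff_apply, h]
  · rw [insert_empty_eq, MulMemClass.coe_mul, h]
    simp only [ringGen]
    rw [X_pow_mul_monomial, Nat.sub_add_cancel h1]

theorem koszulD_of_mem_of_ne_empty {K : Type*} [Field K] {k : ℕ} {n : Fin k → ℕ} {j : ℕ}
    {ω : Finset (Fin k) → semigroupRing K n} (hω : ω ∈ koszulPiece (ringPiece K n) n 1 j)
    {J : Finset (Fin k)} (hJ : J ≠ ∅) : koszulD K (ringGen K n) ω J = 0 := by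
  refine Finset.sum_eq_zero fun l hl => ?_
  rcases mem_koszulPiece.1 hω (insert l J) with h | h
  · rw [Finset.card_insert_of_notMem (Finset.mem_compl.1 hl)] at h
    exact absurd (Finset.card_eq_zero.1 (by omega)) hJ
  · rw [h, mul_zero]

/-- Only the `∅` component of the differential can be nonzero, and it is `t^j` times the sum of the
coefficients; being a cycle is thus one scalar equation. -/
theorem mem_koszulCycles_one_iff {K : Type*} [Field K] {k : ℕ} {n : Fin k → ℕ} {j : ℕ}
    {ω : Finset (Fin k) → semigroupRing K n} (hω : ω ∈ koszulPiece (ringPiece K n) n 1 j) :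
    ω ∈ koszulCycles (ringPiece K n) n (ringGen K n) 1 j ↔
      vertexCoeff K n j ω ∈ vertexCycles K n j := by
  have hv : ∀ l, ¬ IsVertex n j l → vertexCoeff K n j ω l = 0 := fun l hl => by
    rcases vertex_of_mem_koszulPiece_one hω l with h | h
    · simp [vertexCoeff_apply, h]
    · exact absurd h.2.1 hl
  have key : koszulD K (ringGen K n) ω = 0 ↔ ∑ l, vertexCoeff K n j ω l = 0 := by
    rw [← monomial_eq_zero_iff (∑ l, _) j, ← koszulD_empty_of_mem hω]
    constructor
    · intro h
      simp [h]
    · intro h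
      funext J
      by_cases hJ : J = ∅
      · subst hJ
        exact Subtype.ext h
      · exact koszulD_of_mem_of_ne_empty hω hJ
  simp only [koszulCycles, Submodule.mem_inf, hω, true_and, LinearMap.mem_ker, key]
  exact ⟨fun h => ⟨hv, h⟩, fun h => h.2⟩

theorem vertexCoeff_injOn {K : Type*} [Field K] {k : ℕ} {n : Fin k → ℕ} {j : ℕ}
    {ω : Finset (Fin k) → semigroupRing K n} (hω : ω ∈ koszulPiece (ringPiece K n) n 1 j)
    (h : vertexCoeff K n j ω = 0) : ω = 0 := by
  funext I
  rcases mem_koszulPiece.1 hω I with ⟨hI, -⟩ | hI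
  · obtain ⟨l, rfl⟩ := Finset.card_eq_one.1 hI
    rcases vertex_of_mem_koszulPiece_one hω l with h' | ⟨-, -, h'⟩
    · exact h'
    · apply Subtype.ext
      rw [h', h]
      simp
  · exact hI

theorem exists_vertexCoeff_eq {K : Type*} [Field K] {k : ℕ} {n : Fin k → ℕ} {j : ℕ} {c : Fin k → K}
    (hc : ∀ l, ¬ IsVertex n j l → c l = 0) :
    ∃ ω ∈ koszulPiece (ringPiece K n) n 1 j, vertexCoeff K n j ω = c := by
  have hm : ∀ l, monomial (j - n l) (c l) ∈ semigroupRing K n := fun l => by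
    by_cases h : IsVertex n j l
    · obtain ⟨s, hs, h⟩ := h
      exact monomial_mem_semigroupRing (by rwa [show j - n l = s by omega]) _
    · rw [hc l h, map_zero]
      exact zero_mem _
  let ω : Finset (Fin k) → semigroupRing K n := ∑ l, Pi.single {l} ⟨_, hm l⟩
  have hω : ∀ l, ω {l} = ⟨_, hm l⟩ := fun l => by
    simp only [ω, Finset.sum_apply]
    rw [Finset.sum_eq_single l]
    · simp
    · intro b _ hb
      rw [Pi.single_eq_of_ne]
      simpa using hb.symm
    · simp
  refine ⟨ω, mem_koszulPiece.2 fun I => ?_, ?_⟩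
  · by_cases hI : I.card = 1
    · obtain ⟨l, rfl⟩ := Finset.card_eq_one.1 hI
      by_cases h : IsVertex n j l
      · obtain ⟨s, hs, h⟩ := h
        refine Or.inl ⟨hI, by simp only [Finset.sum_singleton]; omega, ?_⟩
        rw [hω, mem_ringPiece]
        exact ⟨c l, by simp⟩
      · right
        rw [hω]
        apply Subtype.ext
        simp [hc l h]
    · right
      simp only [ω, Finset.sum_apply]
      refine Finset.sum_eq_zero fun l _ => ?_
      rw [Pi.single_eq_of_ne]
      rintro rfl
      simp at hI
  · funext l
    rw [vertexCoeff_apply, hω]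
    simp

/-- The differential of `t^s e_{l,l'}` is an oriented edge; the sign comes from the position of the
removed index in `{l, l'}`. -/
theorem vertexCoeff_koszulD_single {K : Type*} [Field K] {k : ℕ} {n : Fin k → ℕ} {j s : ℕ}
    {l l' : Fin k} (hl : l < l') (hj : s + n l + n l' = j) {r : semigroupRing K n} {c : K}
    (hr : (r : K[X]) = monomial s c) :
    vertexCoeff K n j (koszulD K (ringGen K n) (Pi.single {l, l'} r)) =
      c • (Pi.single l' 1 - Pi.single l 1) := by
  funext p
  rw [vertexCoeff_apply]
  simp only [koszulD, LinearMap.coe_mk, AddHom.coe_mk, Pi.smul_apply, Pi.sub_apply]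
  by_cases hp : p = l
  · subst hp
    rw [Finset.sum_eq_single l']
    · rw [show insert l' {p} = ({p, l'} : Finset (Fin k)) from Finset.pair_comm _ _,
        Pi.single_eq_same, Finset.filter_singleton, if_pos hl]
      simp only [Finset.card_singleton, pow_one, neg_mul, NegMemClass.coe_neg, OneMemClass.coe_one,
        one_mul,
        MulMemClass.coe_mul, hr, ringGen, X_pow_mul_monomial, coeff_neg, coeff_monomial]
      rw [if_pos (by omega)]
      simp [hl.ne]
    · intro q _ hq
      rw [Pi.single_eq_of_ne, mul_zero]
      intro h
      have : l' ∈ insert q ({p} : Finset (Fin k)) := by rw [h]; simp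
      simp [hq.symm, hl.ne'] at this
    · intro h
      simp [hl.ne'] at h
  by_cases hp' : p = l'
  · subst hp'
    rw [Finset.sum_eq_single l]
    · rw [Pi.single_eq_same, Finset.filter_singleton, if_neg hl.not_gt]
      simp only [Finset.card_empty, pow_zero, one_mul,
        MulMemClass.coe_mul, hr, ringGen, X_pow_mul_monomial, coeff_monomial]
      rw [if_pos (by omega)]
      simp [hl.ne']
    · intro q _ hq
      rw [Pi.single_eq_of_ne, mul_zero]
      intro h
      have : l ∈ insert q ({p} : Finset (Fin k)) := by rw [h]; simp
      simp [hq.symm, hl.ne] at this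
    · intro h
      simp [hl.ne] at h
  · rw [Finset.sum_eq_zero]
    · simp [hp, hp']
    · intro q _
      rw [Pi.single_eq_of_ne, mul_zero]
      intro h
      have : p ∈ ({l, l'} : Finset (Fin k)) := by rw [← h]; simp
      simp [hp, hp'] at this

theorem map_vertexCoeff_koszulBoundaries (K : Type*) [Field K] {k : ℕ} (n : Fin k → ℕ) (j : ℕ) :
    (koszulBoundaries (ringPiece K n) n (ringGen K n) 1 j).map (vertexCoeff K n j) =
      edgeBoundaries K n j := by
  apply le_antisymm
  · rintro _ ⟨_, ⟨ω, hω, rfl⟩, rfl⟩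
    -- By linearity it suffices to treat one basis element `e_I` with `I` a pair.
    have hsum : ω = ∑ I, Pi.single I (ω I) := (Finset.univ_sum_single ω).symm
    rw [hsum, map_sum, map_sum]
    refine sum_mem fun I _ => ?_
    rcases mem_koszulPiece.1 hω I with ⟨hI, h1, h2⟩ | h
    · obtain ⟨a, b, hab, rfl⟩ := Finset.card_eq_two.1 hI
      wlog hlt : a < b generalizing a b
      · rw [Finset.pair_comm] at h1 h2 hI ⊢
        exact this b a hab.symm (by simp) hI h1 h2 (lt_of_le_of_ne (not_lt.1 hlt) hab.symm)
      rw [Finset.sum_pair hab] at h1 h2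
      rcases eq_zero_or_mem_of_mem_ringPiece h2 with h | h
      · simp [h]
      · obtain ⟨c, hc⟩ := mem_ringPiece.1 h2
        rw [vertexCoeff_koszulD_single hlt (by omega) hc]
        exact Submodule.smul_mem _ _ (single_sub_single_mem_edgeBoundaries K
          ⟨hab.symm, _, h, by omega⟩)
    · simp [h]
  · refine Submodule.span_le.2 ?_
    rintro _ ⟨a, b, hab, rfl⟩
    wlog hlt : b < a generalizing a b
    · rw [← neg_sub, SetLike.mem_coe, neg_mem_iff]
      exact this b a hab.symm (lt_of_le_of_ne (not_lt.1 hlt) hab.1)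
    obtain ⟨hne, s, hs, h⟩ := hab
    refine ⟨_, ⟨Pi.single {b, a} ⟨_, monomial_mem_semigroupRing hs 1⟩, ?_, rfl⟩, ?_⟩
    · refine mem_koszulPiece.2 fun I => ?_
      by_cases hI : I = {b, a}
      · subst hI
        refine Or.inl ⟨Finset.card_pair hne.symm, ?_⟩
        rw [Finset.sum_pair hne.symm]
        refine ⟨by omega, ?_⟩
        rw [Pi.single_eq_same, mem_ringPiece, show j - (n b + n a) = s by omega]
        exact ⟨1, rfl⟩
      · exact Or.inr (Pi.single_eq_of_ne hI _)
    · rw [vertexCoeff_koszulD_single hlt (by omega) rfl, one_smul]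

theorem koszulBoundaries_one_le (K : Type*) [Field K] {k : ℕ} (n : Fin k → ℕ) (j : ℕ) :
    koszulBoundaries (ringPiece K n) n (ringGen K n) 1 j ≤ koszulPiece (ringPiece K n) n 1 j := by
  rintro _ ⟨ω, hω, rfl⟩
  have hmem : ∀ J : Finset (Fin k), J.card = 1 ∧ ∑ l ∈ J, n l ≤ j →
      koszulD K (ringGen K n) ω J ∈ ringPiece K n (j - ∑ l ∈ J, n l) := fun J hJ => by
    refine sum_mem fun l hl => ?_
    rw [Finset.mem_compl] at hl
    rcases mem_koszulPiece.1 hω (insert l J) with ⟨-, h1, h2⟩ | h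
    · rw [Finset.sum_insert hl] at h1 h2
      obtain ⟨c, hc⟩ := mem_ringPiece.1 h2
      have : ringGen K n l * ω (insert l J) ∈ ringPiece K n (j - ∑ l ∈ J, n l) := by
        refine mem_ringPiece.2 ⟨c, ?_⟩
        rw [MulMemClass.coe_mul, hc]
        simp only [ringGen]
        rw [X_pow_mul_monomial, show j - (n l + ∑ l ∈ J, n l) + n l = j - ∑ l ∈ J, n l by omega]
      rw [mul_assoc]
      rcases neg_one_pow_eq_or (semigroupRing K n) (J.filter (· < l)).card with h | h
      · simpa [h] using this
      · simpa [h] using this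
    · simp [h]
  refine mem_koszulPiece.2 fun J => ?_
  by_cases hJ : J.card = 1 ∧ ∑ l ∈ J, n l ≤ j
  · exact Or.inl ⟨hJ.1, hJ.2, hmem J hJ⟩
  · refine Or.inr (Finset.sum_eq_zero fun l hl => ?_)
    rw [Finset.mem_compl] at hl
    rcases mem_koszulPiece.1 hω (insert l J) with ⟨h0, h1, -⟩ | h
    · rw [Finset.card_insert_of_notMem hl] at h0
      rw [Finset.sum_insert hl] at h1
      exact absurd ⟨by omega, by omega⟩ hJ
    · simp [h]

/-- The first Betti numbers are dimensions of reduced simplicial homology groups. -/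
theorem betti_one_eq_finrank (K : Type*) [Field K] {k : ℕ} (n : Fin k → ℕ) (j : ℕ) :
    betti K n 1 j = Module.finrank K
      (vertexCycles K n j ⧸ (edgeBoundaries K n j).submoduleOf (vertexCycles K n j)) := by
  let Z := koszulCycles (ringPiece K n) n (ringGen K n) 1 j
  have hZ : ∀ ω ∈ Z, ω ∈ koszulPiece (ringPiece K n) n 1 j := fun ω hω => hω.1
  let F : Z →ₗ[K] vertexCycles K n j :=
    (vertexCoeff K n j).restrict fun ω hω => (mem_koszulCycles_one_iff (hZ ω hω)).1 hω
  have hF : Function.Bijective F := by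
    constructor
    · rintro ⟨ω, hω⟩ ⟨η, hη⟩ h
      have h' : vertexCoeff K n j ω = vertexCoeff K n j η := congrArg Subtype.val h
      exact Subtype.ext (sub_eq_zero.1 (vertexCoeff_injOn (sub_mem (hZ ω hω) (hZ η hη))
        (by rw [map_sub, h', sub_self])))
    · rintro ⟨c, hc⟩
      obtain ⟨ω, hω, rfl⟩ := exists_vertexCoeff_eq hc.1
      exact ⟨⟨ω, (mem_koszulCycles_one_iff hω).2 hc⟩, rfl⟩
  refine LinearEquiv.finrank_eq (Submodule.Quotient.equiv _ _ (LinearEquiv.ofBijective F hF) ?_)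
  ext ⟨c, hc⟩
  simp only [Submodule.mem_map, Submodule.submoduleOf, Submodule.mem_comap, Submodule.subtype_apply]
  rw [← map_vertexCoeff_koszulBoundaries]
  constructor
  · rintro ⟨⟨ω, hω⟩, h1, h2⟩
    exact ⟨ω, h1, congrArg Subtype.val h2⟩
  · rintro ⟨ω, h1, h2⟩
    -- No appeal to `∂ ∘ ∂ = 0`: the coefficients of `ω` form `c`, already known to be a vertex
    -- cycle.
    have h3 : ω ∈ Z := (mem_koszulCycles_one_iff (koszulBoundaries_one_le K n j h1)).2
      (by rwa [h2])
    exact ⟨⟨ω, h3⟩, h1, Subtype.ext h2⟩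

/-! ### Euler characteristic and vanishing criteria -/

theorem gen_mem_semigroup {k : ℕ} (n : Fin k → ℕ) (l : Fin k) : n l ∈ semigroup n :=
  AddSubmonoid.subset_closure ⟨l, rfl⟩

theorem IsVertex.mem_semigroup {k : ℕ} {n : Fin k → ℕ} {j : ℕ} {l : Fin k}
    (h : IsVertex n j l) : j ∈ semigroup n := by
  obtain ⟨s, hs, rfl⟩ := h
  exact add_mem hs (gen_mem_semigroup n l)

theorem exists_isVertex {k : ℕ} {n : Fin k → ℕ} {j : ℕ} (hj : j ∈ semigroup n) (h0 : j ≠ 0) :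
    ∃ l, IsVertex n j l := by
  induction hj using AddSubmonoid.closure_induction with
  | mem x hx =>
    obtain ⟨l, rfl⟩ := hx
    exact ⟨l, 0, zero_mem _, zero_add _⟩
  | zero => exact absurd rfl h0
  | add x y hx hy hx' hy' =>
    by_cases h : x = 0
    · subst h
      simpa using hy' (by simpa using h0)
    · obtain ⟨l, s, hs, hl⟩ := hx' h
      exact ⟨l, s + y, add_mem hs hy, by omega⟩

open Classical in
/-- The number of vertices of the squarefree divisor complex of `j`. -/
noncomputable def vertexCount {k : ℕ} (n : Fin k → ℕ) (j : ℕ) : ℕ :=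
  ∑ l, if IsVertex n j l then 1 else 0

/-- Vertex cycles form the kernel of the coefficient sum on functions on the vertices; a vertex is
needed for that sum to be surjective. -/
theorem finrank_vertexCycles_add_one (K : Type*) [Field K] {k : ℕ} {n : Fin k → ℕ} {j : ℕ}
    (h : ∃ l, IsVertex n j l) :
    Module.finrank K (vertexCycles K n j) + 1 = vertexCount n j := by
  classical
  let V := {l // IsVertex n j l}
  let σ : (V → K) →ₗ[K] K := ∑ l, LinearMap.proj l
  have hσ : ∀ c, σ c = ∑ l, c l := fun c => by simp [σ]
  have hsum : ∀ c : Fin k → K, (∀ l, ¬ IsVertex n j l → c l = 0) →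
      ∑ l : V, c l = ∑ l, c l := fun c hc => by
    rw [← Finset.sum_subtype (Finset.univ.filter (IsVertex n j)) (by simp) c]
    exact Finset.sum_filter_of_ne fun l _ hl => by_contra fun h' => hl (hc l h')
  let F : vertexCycles K n j →ₗ[K] LinearMap.ker σ :=
    (LinearMap.funLeft K K (Subtype.val : V → Fin k)).restrict fun c hc => by
      rw [LinearMap.mem_ker, hσ]
      exact (hsum c hc.1).trans hc.2
  have hF : Function.Bijective F := by
    constructor
    · refine (injective_iff_map_eq_zero F).2 ?_
      rintro ⟨c, hc⟩ h0
      apply Subtype.ext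
      funext l
      by_cases hl : IsVertex n j l
      · exact congrFun (congrArg Subtype.val h0) ⟨l, hl⟩
      · exact hc.1 l hl
    · rintro ⟨c, hc⟩
      have h1 : ∀ l, ¬ IsVertex n j l → (if h : IsVertex n j l then c ⟨l, h⟩ else 0) = 0 :=
        fun l hl => dif_neg hl
      have h2 : ∀ l : V, (if h : IsVertex n j l then c ⟨l, h⟩ else 0) = c l :=
        fun l => dif_pos l.2
      refine ⟨⟨fun l => if h : IsVertex n j l then c ⟨l, h⟩ else 0, h1, ?_⟩, ?_⟩
      · rw [← hsum _ h1]
        simp only [h2]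
        rw [← hσ]
        exact hc
      · exact Subtype.ext (funext h2)
  have hsurj : LinearMap.range σ = ⊤ := by
    obtain ⟨l, hl⟩ := h
    refine LinearMap.range_eq_top.2 fun a => ⟨Pi.single ⟨l, hl⟩ a, ?_⟩
    rw [hσ]
    simp
  have := LinearMap.finrank_range_add_finrank_ker σ
  rw [hsurj, finrank_top, Module.finrank_self, Module.finrank_fintype_fun_eq_card] at this
  rw [(LinearEquiv.ofBijective F hF).finrank_eq, add_comm, this, vertexCount, Fintype.card_subtype,
    Finset.card_filter]

/-- The simplicial `0`-cocycles, not required to vanish outside the vertices. -/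
def edgeCocycles (K : Type*) [Field K] {k : ℕ} (n : Fin k → ℕ) (j : ℕ) :
    Submodule K (Fin k → K) where
  carrier := {φ | ∀ l l', IsEdge n j l l' → φ l = φ l'}
  zero_mem' := fun _ _ _ => rfl
  add_mem' := fun ha hb l l' h => by simp [ha l l' h, hb l l' h]
  smul_mem' := fun c a ha l l' h => by simp [ha l l' h]

/-- Under the dot product, cocycles are the annihilator of the edge boundaries. Indices that are not
vertices count as free coordinates of the cocycles. -/
theorem finrank_edgeBoundaries_add (K : Type*) [Field K] {k : ℕ} (n : Fin k → ℕ) (j : ℕ) :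
    Module.finrank K (edgeBoundaries K n j) + Module.finrank K (edgeCocycles K n j) = k := by
  have h : (edgeCocycles K n j).map (dotProductEquiv K (Fin k)).toLinearMap =
      (edgeBoundaries K n j).dualAnnihilator := by
    ext ψ
    obtain ⟨φ, rfl⟩ := (dotProductEquiv K (Fin k)).surjective ψ
    rw [Submodule.mem_dualAnnihilator]
    constructor
    · rintro ⟨φ', hφ, he⟩ b hb
      obtain rfl := (dotProductEquiv K (Fin k)).injective he
      have : edgeBoundaries K n j ≤ LinearMap.ker (dotProductEquiv K (Fin k) φ') := by
        refine Submodule.span_le.2 ?_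
        rintro _ ⟨l, l', hl, rfl⟩
        simp [dotProduct_sub, hφ l l' hl]
      exact this hb
    · intro hψ
      refine ⟨φ, fun l l' hl => ?_, rfl⟩
      have := hψ _ (single_sub_single_mem_edgeBoundaries K hl)
      simpa [dotProduct_sub, sub_eq_zero] using this
  have h' := LinearEquiv.finrank_map_eq (dotProductEquiv K (Fin k)) (edgeCocycles K n j)
  rw [h] at h'
  rw [← h', Subspace.finrank_add_finrank_dualAnnihilator_eq, Module.finrank_fin_fun]

theorem betti_one_add_finrank (K : Type*) [Field K] {k : ℕ} (n : Fin k → ℕ) (j : ℕ) :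
    betti K n 1 j + Module.finrank K (edgeBoundaries K n j) =
      Module.finrank K (vertexCycles K n j) := by
  rw [betti_one_eq_finrank, ← Submodule.finrank_quotient_add_finrank
    ((edgeBoundaries K n j).submoduleOf (vertexCycles K n j)),
    (Submodule.submoduleOfEquivOfLe (edgeBoundaries_le_vertexCycles K n j)).finrank_eq]

/-- The Euler characteristic formula for the first Betti numbers. -/
theorem betti_one_add_eq (K : Type*) [Field K] {k : ℕ} {n : Fin k → ℕ} {j : ℕ}
    (h : ∃ l, IsVertex n j l) :
    betti K n 1 j + k + 1 = vertexCount n j + Module.finrank K (edgeCocycles K n j) := by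
  have h1 := betti_one_add_finrank K n j
  have h2 := finrank_edgeBoundaries_add K n j
  have h3 := finrank_vertexCycles_add_one K h
  omega

theorem betti_one_eq_zero_of_le {K : Type*} [Field K] {k : ℕ} {n : Fin k → ℕ} {j : ℕ}
    (h : vertexCycles K n j ≤ edgeBoundaries K n j) : betti K n 1 j = 0 := by
  have h1 := betti_one_add_finrank K n j
  have h2 := Submodule.finrank_mono h
  omega

theorem betti_one_eq_zero_of_forall_not (K : Type*) [Field K] {k : ℕ} {n : Fin k → ℕ} {j : ℕ}
    (h : ∀ l, ¬ IsVertex n j l) : betti K n 1 j = 0 := by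
  refine betti_one_eq_zero_of_le fun c hc => ?_
  rw [show c = 0 from funext fun l => hc.1 l (h l)]
  exact zero_mem _

theorem betti_one_eq_zero_of_notMem (K : Type*) [Field K] {k : ℕ} {n : Fin k → ℕ} {j : ℕ}
    (h : j ∉ semigroup n) : betti K n 1 j = 0 :=
  betti_one_eq_zero_of_forall_not K fun _ hl => h hl.mem_semigroup

/-- A graph in which `p` is joined to all other vertices is connected: a cycle of coefficient sum
zero is a combination of the edges through `p`. -/
theorem betti_one_eq_zero_of_cone (K : Type*) [Field K] {k : ℕ} {n : Fin k → ℕ} {j : ℕ}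
    (p : Fin k) (h : ∀ l, l ≠ p → IsVertex n j l → IsEdge n j l p) : betti K n 1 j = 0 := by
  refine betti_one_eq_zero_of_le fun c hc => ?_
  have : c = ∑ l, c l • (Pi.single l 1 - Pi.single p 1 : Fin k → K) := by
    simp only [smul_sub, Finset.sum_sub_distrib, ← Finset.sum_smul, hc.2, zero_smul, sub_zero]
    funext q
    simp [Finset.sum_apply, Pi.single_apply]
  rw [this]
  refine sum_mem fun l _ => ?_
  by_cases hl : IsVertex n j l
  · by_cases hlp : l = p
    · simp [hlp]
    · exact Submodule.smul_mem _ _ (single_sub_single_mem_edgeBoundaries K (h l hlp hl))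
  · rw [hc.1 l hl, zero_smul]
    exact zero_mem _

/-! ### Gluing one generator -/

/-- The sequence `U` extends `n` by one generator `y`, and `c` is the least positive multiplier
that brings `y` into the group generated by `n`, where `c * y` even lies in the semigroup. -/
structure IsGluing {k : ℕ} (n : Fin k → ℕ) (U : Fin (k + 1) → ℕ) (c : ℕ) : Prop where
  castSucc_eq : ∀ i, U i.castSucc = n i
  last_pos : 0 < U (Fin.last k)
  multiplier_pos : 0 < c
  mem : c * U (Fin.last k) ∈ semigroup n
  modEq : ∀ s ∈ semigroup n, ∀ s' ∈ semigroup n, ∀ e e' : ℕ,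
    s + e * U (Fin.last k) = s' + e' * U (Fin.last k) → e ≡ e' [MOD c]

namespace IsGluing

variable {k : ℕ} {n : Fin k → ℕ} {U : Fin (k + 1) → ℕ} {c : ℕ}

theorem add_mem_semigroup (h : IsGluing n U c) {s : ℕ} (hs : s ∈ semigroup n) (e : ℕ) :
    s + e * U (Fin.last k) ∈ semigroup U := by
  refine add_mem ?_ ?_
  · refine AddSubmonoid.closure_mono ?_ hs
    rintro _ ⟨i, rfl⟩
    exact ⟨i.castSucc, h.castSucc_eq i⟩
  · rw [← smul_eq_mul]
    exact AddSubmonoid.nsmul_mem _ (gen_mem_semigroup U _) e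

theorem exists_normal_form (h : IsGluing n U c) {x : ℕ} (hx : x ∈ semigroup U) :
    ∃ s ∈ semigroup n, ∃ e < c, s + e * U (Fin.last k) = x := by
  have h1 : ∃ s ∈ semigroup n, ∃ e, s + e * U (Fin.last k) = x := by
    induction hx using AddSubmonoid.closure_induction with
    | mem x hx =>
      obtain ⟨i, rfl⟩ := hx
      induction i using Fin.lastCases with
      | last => exact ⟨0, zero_mem _, 1, by simp⟩
      | cast i => exact ⟨n i, gen_mem_semigroup n i, 0, by simp [h.castSucc_eq]⟩
    | zero => exact ⟨0, zero_mem _, 0, by simp⟩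
    | add x y _ _ hx hy =>
      obtain ⟨s, hs, e, rfl⟩ := hx
      obtain ⟨s', hs', e', rfl⟩ := hy
      exact ⟨s + s', add_mem hs hs', e + e', by ring⟩
  obtain ⟨s, hs, e, rfl⟩ := h1
  -- Each block of `c` copies of the last generator is absorbed into the semigroup of `n`.
  refine ⟨s + (e / c) * (c * U (Fin.last k)), add_mem hs ?_, e % c,
    Nat.mod_lt _ h.multiplier_pos, ?_⟩
  · rw [← smul_eq_mul]
    exact AddSubmonoid.nsmul_mem _ h.mem _
  · conv_rhs => rw [← Nat.div_add_mod e c]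
    ring

theorem normal_form_unique (h : IsGluing n U c) {s s' e e' : ℕ} (hs : s ∈ semigroup n)
    (hs' : s' ∈ semigroup n) (he : e < c) (he' : e' < c)
    (heq : s + e * U (Fin.last k) = s' + e' * U (Fin.last k)) : e = e' ∧ s = s' := by
  have h1 := h.modEq s hs s' hs' e e' heq
  rw [Nat.ModEq, Nat.mod_eq_of_lt he, Nat.mod_eq_of_lt he'] at h1
  subst h1
  exact ⟨rfl, by omega⟩

/-- Subtracting an old element leaves the exponent `e` of the normal form unchanged, so old
generators see only `s`. -/
theorem exists_castSucc_iff (h : IsGluing n U c) {s e a : ℕ} (hs : s ∈ semigroup n) (he : e < c)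
    (ha : a ∈ semigroup n) :
    (∃ x ∈ semigroup U, x + a = s + e * U (Fin.last k)) ↔ ∃ x ∈ semigroup n, x + a = s := by
  constructor
  · rintro ⟨x, hx, hxa⟩
    obtain ⟨s', hs', e', he', rfl⟩ := h.exists_normal_form hx
    obtain ⟨h1, h2⟩ := h.normal_form_unique (add_mem hs' ha) hs he' he (by omega)
    exact ⟨s', hs', h2⟩
  · rintro ⟨x, hx, rfl⟩
    exact ⟨_, h.add_mem_semigroup hx e, by omega⟩

theorem exists_last_iff (h : IsGluing n U c) {s a : ℕ} (hs : s ∈ semigroup n)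
    (ha : a ∈ semigroup n) :
    (∃ x ∈ semigroup U, x + a + U (Fin.last k) = s) ↔
      ∃ x ∈ semigroup n, x + a + c * U (Fin.last k) = s := by
  constructor
  · rintro ⟨x, hx, hxa⟩
    obtain ⟨s', hs', e', he', rfl⟩ := h.exists_normal_form hx
    have h1 : s' + a + (e' + 1) * U (Fin.last k) = s + 0 * U (Fin.last k) := by
      rw [← hxa]
      ring
    have h2 := (Nat.modEq_zero_iff_dvd.1 (h.modEq _ (add_mem hs' ha) _ hs _ _ h1))
    -- The exponent `e' + 1` is a positive multiple of `c` and at most `c`.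
    have h3 : e' + 1 = c := le_antisymm he' (Nat.le_of_dvd (by omega) h2)
    rw [h3] at h1
    exact ⟨s', hs', by omega⟩
  · rintro ⟨x, hx, rfl⟩
    refine ⟨_, h.add_mem_semigroup hx (c - 1), ?_⟩
    obtain ⟨d, rfl⟩ : ∃ d, c = d + 1 := ⟨c - 1, by have := h.multiplier_pos; omega⟩
    simp only [Nat.add_sub_cancel]
    ring

theorem isVertex_castSucc_iff (h : IsGluing n U c) {s e : ℕ} (hs : s ∈ semigroup n) (he : e < c)
    (l : Fin k) : IsVertex U (s + e * U (Fin.last k)) l.castSucc ↔ IsVertex n s l := by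
  rw [IsVertex, IsVertex, h.castSucc_eq]
  exact h.exists_castSucc_iff hs he (gen_mem_semigroup n l)

theorem isEdge_castSucc_iff (h : IsGluing n U c) {s : ℕ} (hs : s ∈ semigroup n)
    (l l' : Fin k) : IsEdge U s l.castSucc l'.castSucc ↔ IsEdge n s l l' := by
  have := h.exists_castSucc_iff hs h.multiplier_pos
    (add_mem (gen_mem_semigroup n l) (gen_mem_semigroup n l'))
  simp only [zero_mul, add_zero, ← add_assoc] at this
  rw [IsEdge, IsEdge, h.castSucc_eq, h.castSucc_eq, this, Ne, Ne, Fin.castSucc_inj]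

theorem isVertex_last_iff (h : IsGluing n U c) {s : ℕ} (hs : s ∈ semigroup n) :
    IsVertex U s (Fin.last k) ↔ ∃ x ∈ semigroup n, x + c * U (Fin.last k) = s := by
  simpa [IsVertex] using h.exists_last_iff hs (zero_mem _)

theorem isEdge_last_iff (h : IsGluing n U c) {s : ℕ} (hs : s ∈ semigroup n) (l : Fin k) :
    IsEdge U s l.castSucc (Fin.last k) ↔
      ∃ x ∈ semigroup n, x + n l + c * U (Fin.last k) = s := by
  rw [IsEdge, h.castSucc_eq, h.exists_last_iff hs (gen_mem_semigroup n l)]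
  simp [Fin.castSucc_ne_last]

/-- With `e > 0` a copy of the last generator can always be removed, which makes it a cone point. -/
theorem betti_of_pos (h : IsGluing n U c) (K : Type*) [Field K] {s e : ℕ} (hs : s ∈ semigroup n)
    (he : e < c) (h0 : 0 < e) : betti K U 1 (s + e * U (Fin.last k)) = 0 := by
  refine betti_one_eq_zero_of_cone K (Fin.last k) fun l => ?_
  induction l using Fin.lastCases with
  | last => exact fun h => absurd rfl h
  | cast l =>
    intro hne hl
    obtain ⟨x, hx, rfl⟩ := (h.isVertex_castSucc_iff hs he l).1 hl
    refine ⟨hne, _, h.add_mem_semigroup hx (e - 1), ?_⟩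
    obtain ⟨d, rfl⟩ : ∃ d, e = d + 1 := ⟨e - 1, by omega⟩
    rw [h.castSucc_eq, Nat.add_sub_cancel]
    ring

open Classical in
theorem castSucc_vertexCount (h : IsGluing n U c) {s : ℕ} (hs : s ∈ semigroup n) :
    (IsVertex U s (Fin.last k) → vertexCount U s = vertexCount n s + 1) ∧
    (¬ IsVertex U s (Fin.last k) → vertexCount U s = vertexCount n s) := by
  have := h.isVertex_castSucc_iff hs h.multiplier_pos
  simp only [zero_mul, add_zero] at this
  have hsum : vertexCount U s =
      vertexCount n s + if IsVertex U s (Fin.last k) then 1 else 0 := by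
    rw [vertexCount, vertexCount, Fin.sum_univ_castSucc]
    exact congrArg₂ _ (Finset.sum_congr rfl fun l _ => if_congr (this l) rfl rfl) rfl
  exact ⟨fun h => by rw [hsum, if_pos h], fun h => by rw [hsum, if_neg h, add_zero]⟩

theorem castSucc_mem_edgeCocycles (h : IsGluing n U c) {K : Type*} [Field K] {s : ℕ}
    (hs : s ∈ semigroup n) {φ : Fin (k + 1) → K} (hφ : φ ∈ edgeCocycles K U s) :
    (fun i => φ (Fin.castSucc i)) ∈ edgeCocycles K n s :=
  fun l l' hl => hφ _ _ ((h.isEdge_castSucc_iff hs l l').2 hl)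

theorem mem_edgeCocycles (h : IsGluing n U c) {K : Type*} [Field K] {s : ℕ}
    (hs : s ∈ semigroup n) {φ : Fin (k + 1) → K}
    (hφ : (fun i => φ (Fin.castSucc i)) ∈ edgeCocycles K n s)
    (hl : ∀ l : Fin k, IsEdge U s l.castSucc (Fin.last k) → φ l.castSucc = φ (Fin.last k)) :
    φ ∈ edgeCocycles K U s := by
  intro l l' hll
  induction l using Fin.lastCases with
  | last =>
    induction l' using Fin.lastCases with
    | last => rfl
    | cast l' => exact (hl l' hll.symm).symm
  | cast l =>
    induction l' using Fin.lastCases with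
    | last => exact hl l hll
    | cast l' => exact hφ _ _ ((h.isEdge_castSucc_iff hs l l').1 hll)

/-- Without edges at the last index, the cocycle's value there is free. -/
theorem finrank_edgeCocycles_of_isolated (h : IsGluing n U c) (K : Type*) [Field K] {s : ℕ}
    (hs : s ∈ semigroup n) (hl : ∀ l : Fin k, ¬ IsEdge U s l.castSucc (Fin.last k)) :
    Module.finrank K (edgeCocycles K U s) = Module.finrank K (edgeCocycles K n s) + 1 := by
  let F : edgeCocycles K U s →ₗ[K] edgeCocycles K n s × K :=
    ((LinearMap.funLeft K K (Fin.castSucc : Fin k → _)).restrict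
      fun φ hφ => h.castSucc_mem_edgeCocycles hs hφ).prod
      ((LinearMap.proj (Fin.last k)).comp (edgeCocycles K U s).subtype)
  have hF : Function.Bijective F := by
    constructor
    · rintro ⟨φ, hφ⟩ ⟨ψ, hψ⟩ hh
      obtain ⟨h1, h2⟩ := Prod.ext_iff.1 hh
      apply Subtype.ext
      funext l
      induction l using Fin.lastCases with
      | last => exact h2
      | cast l => exact congrFun (congrArg Subtype.val h1) l
    · rintro ⟨⟨φ, hφ⟩, a⟩
      refine ⟨⟨Fin.snoc (α := fun _ => K) φ a, ?_⟩, ?_⟩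
      · refine h.mem_edgeCocycles hs ?_ fun l hl' => absurd hl' (hl l)
        simpa using hφ
      · refine Prod.ext (Subtype.ext (funext fun l => ?_)) ?_
        · exact Fin.snoc_castSucc (α := fun _ => K) ..
        · exact Fin.snoc_last (α := fun _ => K) ..
  rw [(LinearEquiv.ofBijective F hF).finrank_eq, Module.finrank_prod, Module.finrank_self]

theorem finrank_edgeCocycles_of_edge (h : IsGluing n U c) (K : Type*) [Field K] {s : ℕ}
    (hs : s ∈ semigroup n) {l₀ : Fin k} (hl : IsEdge U s l₀.castSucc (Fin.last k)) :
    Module.finrank K (edgeCocycles K U s) = Module.finrank K (edgeCocycles K n s) := by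
  let F : edgeCocycles K U s →ₗ[K] edgeCocycles K n s :=
    (LinearMap.funLeft K K (Fin.castSucc : Fin k → _)).restrict
      fun φ hφ => h.castSucc_mem_edgeCocycles hs hφ
  have hF : Function.Bijective F := by
    constructor
    · rintro ⟨φ, hφ⟩ ⟨ψ, hψ⟩ h1
      have h2 : ∀ l : Fin k, φ l.castSucc = ψ l.castSucc :=
        fun l => congrFun (congrArg Subtype.val h1) l
      apply Subtype.ext
      funext l
      induction l using Fin.lastCases with
      | last =>
        change φ _ = ψ _
        rw [← hφ _ _ hl, ← hψ _ _ hl, h2]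
      | cast l => exact h2 l
    · rintro ⟨φ, hφ⟩
      -- All old neighbours of the last index lie in one old component: if `s = x + n l + c * y` and
      -- `c * y = v + n p`, then `l` and `p` are equal or joined. The value at `p` therefore extends
      -- the cocycle.
      obtain ⟨p, v, hv, hp⟩ := exists_isVertex h.mem
        (Nat.mul_pos h.multiplier_pos h.last_pos).ne'
      refine ⟨⟨Fin.snoc (α := fun _ => K) φ (φ p), ?_⟩, ?_⟩
      · refine h.mem_edgeCocycles hs (by simpa using hφ) fun l hl' => ?_
        obtain ⟨x, hx, hxl⟩ := (h.isEdge_last_iff hs l).1 hl'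
        rw [Fin.snoc_castSucc (α := fun _ => K), Fin.snoc_last (α := fun _ => K)]
        by_cases hlp : l = p
        · rw [hlp]
        · exact hφ l p ⟨hlp, x + v, add_mem hx hv, by omega⟩
      · exact Subtype.ext (funext fun l => Fin.snoc_castSucc (α := fun _ => K) ..)
  exact (LinearEquiv.ofBijective F hF).finrank_eq

/-- A gluing adds exactly one minimal relation. -/
theorem betti_one (h : IsGluing n U c) (hn : ∀ i, 0 < n i) (K : Type*) [Field K] (j : ℕ) :
    betti K U 1 j = betti K n 1 j + if j = c * U (Fin.last k) then 1 else 0 := by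
  by_cases hj : j ∈ semigroup U
  swap
  · have h1 : ∀ s ∈ semigroup n, j ≠ s := fun s hs hjs =>
      hj (by simpa [hjs] using h.add_mem_semigroup hs 0)
    rw [betti_one_eq_zero_of_notMem K hj, betti_one_eq_zero_of_notMem K fun hs => h1 j hs rfl,
      if_neg (h1 _ h.mem)]
  obtain ⟨s, hs, e, he, rfl⟩ := h.exists_normal_form hj
  rcases Nat.eq_zero_or_pos e with rfl | h0
  swap
  · have h1 : ∀ s' ∈ semigroup n, s + e * U (Fin.last k) ≠ s' := fun s' hs' hjs => by
      have := (h.normal_form_unique hs hs' he h.multiplier_pos (by simpa using hjs)).1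
      omega
    rw [h.betti_of_pos K hs he h0, betti_one_eq_zero_of_notMem K fun hs => h1 _ hs rfl,
      if_neg (h1 _ h.mem)]
  simp only [zero_mul, add_zero] at hj ⊢
  have hc0 := Nat.mul_pos h.multiplier_pos h.last_pos
  -- At `s = 0` both graphs are empty, so the Euler formula is unavailable, but both Betti numbers
  -- vanish.
  rcases Nat.eq_zero_or_pos s with rfl | hs0
  · have hU : ∀ i, 0 < U i := fun i => by
      induction i using Fin.lastCases with
      | last => exact h.last_pos
      | cast i => rw [h.castSucc_eq]; exact hn i
    rw [betti_one_eq_zero_of_forall_not K, betti_one_eq_zero_of_forall_not K, if_neg (by omega)]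
    · rintro l ⟨x, -, hx⟩
      have := hn l
      omega
    · rintro l ⟨x, -, hx⟩
      have := hU l
      omega
  have e1 := betti_one_add_eq K (exists_isVertex hs hs0.ne')
  have e2 := betti_one_add_eq K (exists_isVertex hj hs0.ne')
  obtain ⟨v1, v2⟩ := h.castSucc_vertexCount hs
  -- Passing from `k` to `k + 1`, the Euler formula gains one if the vertex count and the cocycle
  -- dimension both grow (`s = c * y`), and is balanced if only one of them does.
  by_cases hv : IsVertex U s (Fin.last k)
  · have v3 := v1 hv
    obtain ⟨x, hx, hxs⟩ := (h.isVertex_last_iff hs).1 hv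
    rcases Nat.eq_zero_or_pos x with rfl | hx0
    · rw [if_pos (by omega)]
      have e3 := h.finrank_edgeCocycles_of_isolated K hs fun l hl => by
        obtain ⟨x, -, hx⟩ := (h.isEdge_last_iff hs l).1 hl
        have := hn l
        omega
      omega
    · rw [if_neg (by omega)]
      obtain ⟨l, x', hx', hl⟩ := exists_isVertex hx hx0.ne'
      have e3 := h.finrank_edgeCocycles_of_edge K hs
        ((h.isEdge_last_iff hs l).2 ⟨x', hx', by omega⟩)
      omega
  · have v3 := v2 hv
    rw [if_neg fun hsc => hv ((h.isVertex_last_iff hs).2 ⟨0, zero_mem _, by omega⟩)]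
    have e3 := h.finrank_edgeCocycles_of_isolated K hs fun l hl => hv hl.symm.left
    omega

end IsGluing

/-! ### Telescopic sequences as iterated gluings -/

theorem mul_mem_closure_image {ι : Type*} {f g : ι → ℕ} {s : Set ι} {d x : ℕ}
    (hx : x ∈ AddSubmonoid.closure (f '' s)) (hfg : ∀ i ∈ s, d * f i = g i) :
    d * x ∈ AddSubmonoid.closure (g '' s) := by
  induction hx using AddSubmonoid.closure_induction with
  | mem x hx =>
    obtain ⟨i, hi, rfl⟩ := hx
    exact AddSubmonoid.subset_closure ⟨i, hi, (hfg i hi).symm⟩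
  | zero => exact zero_mem _
  | add x y _ _ hx hy => rw [mul_add]; exact add_mem hx hy

theorem dvd_of_mem_semigroup {k : ℕ} {n : Fin k → ℕ} {d s : ℕ} (hd : ∀ i, d ∣ n i)
    (hs : s ∈ semigroup n) : d ∣ s := by
  induction hs using AddSubmonoid.closure_induction with
  | mem x hx =>
    obtain ⟨i, rfl⟩ := hx
    exact hd i
  | zero => exact dvd_zero d
  | add x y _ _ hx hy => exact dvd_add hx hy

theorem gcdUpTo_eq {k : ℕ} (n : Fin k → ℕ) (i : Fin k) :
    gcdUpTo n i = Nat.gcd (gcdBefore n i) (n i) := by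
  rw [gcdUpTo, gcdBefore, ← Finset.Iio_insert, Finset.gcd_insert, Nat.gcd_comm]
  rfl

theorem gcdBefore_castSucc {k : ℕ} (U : Fin (k + 1) → ℕ) (i : Fin k) :
    gcdBefore U i.castSucc = gcdBefore (fun l : Fin k => U l.castSucc) i := by
  refine Nat.dvd_antisymm (Finset.dvd_gcd fun l hl => Finset.gcd_dvd ?_)
    (Finset.dvd_gcd fun l hl => ?_)
  · simpa using hl
  · induction l using Fin.lastCases with
    | last => simp [Fin.lt_def] at hl; omega
    | cast l => exact Finset.gcd_dvd (f := fun l : Fin k => U l.castSucc) (by simpa using hl)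

theorem relationDegree_castSucc {k : ℕ} (U : Fin (k + 1) → ℕ) (i : Fin k) :
    relationDegree U i.castSucc = relationDegree (fun l : Fin k => U l.castSucc) i := by
  simp only [relationDegree, gcdUpTo_eq, gcdBefore_castSucc]

theorem image_Iio_castSucc {k : ℕ} (U : Fin (k + 1) → ℕ) (i : Fin k) :
    U '' Set.Iio i.castSucc = (fun l : Fin k => U l.castSucc) '' Set.Iio i := by
  ext x
  constructor
  · rintro ⟨l, hl, rfl⟩
    induction l using Fin.lastCases with
    | last => simp [Fin.lt_def] at hl; omega
    | cast l => exact ⟨l, by simpa using hl, rfl⟩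
  · rintro ⟨l, hl, rfl⟩
    exact ⟨l.castSucc, by simpa using hl, rfl⟩

theorem image_Iio_last {k : ℕ} (U : Fin (k + 1) → ℕ) :
    U '' Set.Iio (Fin.last k) = Set.range (fun l : Fin k => U l.castSucc) := by
  ext x
  constructor
  · rintro ⟨l, hl, rfl⟩
    induction l using Fin.lastCases with
    | last => simp at hl
    | cast l => exact ⟨l, rfl⟩
  · rintro ⟨l, rfl⟩
    exact ⟨l.castSucc, Fin.castSucc_lt_last l, rfl⟩

/-- A positive sequence in which `r_i = (d_{i-1} / d_i) n_i` lies in `⟨n_1, …, n_{i-1}⟩` for every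
`i ≥ 2`. -/
structure IsFreeSequence {k : ℕ} (n : Fin k → ℕ) : Prop where
  pos : ∀ i, 0 < n i
  mem : ∀ i : Fin k, 0 < i.val → relationDegree n i ∈ AddSubmonoid.closure (n '' Set.Iio i)

/-- Dropping the last entry may destroy gcd one, as does doubling; the condition on the `r_i`
survives both, so the induction runs over free sequences. -/
theorem IsFreeSequence.castSucc {k : ℕ} {U : Fin (k + 1) → ℕ} (h : IsFreeSequence U) :
    IsFreeSequence (fun l : Fin k => U l.castSucc) where
  pos i := h.pos _
  mem i hi := by
    rw [← relationDegree_castSucc, ← image_Iio_castSucc]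
    exact h.mem _ hi

/-- The multiplier `d_{i-1} / d_i` is the order of the last entry modulo `d_{i-1}`, which divides
everything generated by the earlier entries. With `k = 0` the gcd of no entries would be `0`. -/
theorem IsFreeSequence.isGluing {k : ℕ} {U : Fin (k + 1) → ℕ} (h : IsFreeSequence U) (hk : 0 < k) :
    IsGluing (fun l : Fin k => U l.castSucc) U
      (gcdBefore U (Fin.last k) / gcdUpTo U (Fin.last k)) := by
  have hdvd : ∀ i : Fin k, gcdBefore U (Fin.last k) ∣ U i.castSucc := fun i =>
    Finset.gcd_dvd (by simp)
  have hpos : 0 < gcdBefore U (Fin.last k) := Nat.pos_of_dvd_of_pos (hdvd ⟨0, hk⟩) (h.pos _)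
  rw [gcdUpTo_eq]
  refine ⟨fun _ => rfl, h.pos _, Nat.div_gcd_pos_of_pos_left _ hpos, ?_, ?_⟩
  · have := h.mem (Fin.last k) hk
    rwa [image_Iio_last, relationDegree, gcdUpTo_eq] at this
  · intro s hs s' hs' e e' heq
    refine Nat.ModEq.cancel_right_div_gcd hpos ?_
    have h1 := (Nat.modEq_zero_iff_dvd.2 (dvd_of_mem_semigroup hdvd hs)).trans
      (Nat.modEq_zero_iff_dvd.2 (dvd_of_mem_semigroup hdvd hs')).symm
    exact Nat.ModEq.add_left_cancel h1 (by rw [heq])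

/-- The first Betti numbers of a free sequence count the degrees `r_2, …, r_k`. -/
theorem IsFreeSequence.betti_one (K : Type*) [Field K] {k : ℕ} {n : Fin k → ℕ}
    (h : IsFreeSequence n) (j : ℕ) :
    betti K n 1 j = ∑ i : Fin k, if 0 < i.val ∧ relationDegree n i = j then 1 else 0 := by
  induction k with
  | zero =>
    rw [betti_one_eq_zero_of_forall_not K fun l => l.elim0]
    rfl
  | succ k ih =>
    rcases Nat.eq_zero_or_pos k with rfl | hk
    · rw [betti_one_eq_zero_of_cone K 0 fun l hl => absurd (Fin.fin_one_eq_zero l) hl]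
      simp
    · rw [(h.isGluing hk).betti_one h.castSucc.pos, ih h.castSucc, Fin.sum_univ_castSucc]
      simp only [relationDegree_castSucc, Fin.val_castSucc, Fin.val_last, hk, true_and]
      congr 1
      exact if_congr eq_comm rfl rfl

/-- Multiplying the telescopic condition by `d_{i-1}` turns `n_i / d_i` into `r_i`. -/
theorem IsTelescopic.isFreeSequence {k : ℕ} {n : Fin k → ℕ} (h : IsTelescopic n) :
    IsFreeSequence n where
  pos := h.pos
  mem i hi := by
    have h1 := mul_mem_closure_image (d := gcdBefore n i) (g := n) (h.mem i hi) fun l hl =>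
      Nat.mul_div_cancel' (Finset.gcd_dvd (by simpa using hl))
    rwa [relationDegree, gcdUpTo_eq, ← Nat.mul_div_right_comm (Nat.gcd_dvd_left _ _),
      Nat.mul_div_assoc _ (Nat.gcd_dvd_right _ _), ← gcdUpTo_eq]

/-! ### Doubling and adjoining an odd generator -/

theorem relationDegree_two_mul {k : ℕ} (n : Fin k → ℕ) (i : Fin k) :
    relationDegree (fun l => 2 * n l) i = 2 * relationDegree n i := by
  have h : gcdBefore (fun l => 2 * n l) i = 2 * gcdBefore n i := by
    rw [gcdBefore, Finset.gcd_mul_left]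
    rfl
  rw [relationDegree, relationDegree, gcdUpTo_eq, gcdUpTo_eq, h, Nat.gcd_mul_left,
    Nat.mul_div_mul_left _ _ two_pos]
  ring

theorem IsFreeSequence.two_mul {k : ℕ} {n : Fin k → ℕ} (h : IsFreeSequence n) :
    IsFreeSequence (fun l => 2 * n l) where
  pos i := Nat.mul_pos two_pos (h.pos i)
  mem i hi := by
    rw [relationDegree_two_mul]
    exact mul_mem_closure_image (h.mem i hi) fun _ _ => rfl

/-- Membership of `m` in the semigroup puts `2 * m` in its double; oddness makes `m` of order 2
modulo the even numbers. -/
theorem isGluing_doubleWith {k : ℕ} {n : Fin k → ℕ} {m : ℕ} (hm : Odd m) (hmn : m ∈ semigroup n) :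
    IsGluing (fun l => 2 * n l) (doubleWith n m) 2 := by
  have hlast : doubleWith n m (Fin.last k) = m := Fin.snoc_last (α := fun _ => ℕ) ..
  refine ⟨fun i => Fin.snoc_castSucc (α := fun _ => ℕ) .., ?_, two_pos, ?_, ?_⟩
  · rw [hlast]
    exact hm.pos
  · rw [hlast, semigroup, ← Set.image_univ]
    rw [semigroup, ← Set.image_univ] at hmn
    exact mul_mem_closure_image hmn fun _ _ => rfl
  · rw [hlast]
    intro s hs s' hs' e e' heq
    refine Nat.ModEq.cancel_right_of_coprime (c := m) (Nat.coprime_two_left.2 hm) ?_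
    have h1 := (Nat.modEq_zero_iff_dvd.2 (dvd_of_mem_semigroup (fun _ => dvd_mul_right 2 _) hs)).trans
      (Nat.modEq_zero_iff_dvd.2 (dvd_of_mem_semigroup (fun _ => dvd_mul_right 2 _) hs')).symm
    exact Nat.ModEq.add_left_cancel h1 (by rw [heq])

theorem IsFreeSequence.betti_one_doubleWith (K : Type*) [Field K] {k : ℕ} {n : Fin k → ℕ}
    (h : IsFreeSequence n) {m : ℕ} (hm : Odd m) (hmn : m ∈ semigroup n) (j : ℕ) :
    betti K (doubleWith n m) 1 j =
      (∑ i : Fin k, if 0 < i.val ∧ 2 * relationDegree n i = j then 1 else 0) +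
        if j = 2 * m then 1 else 0 := by
  rw [(isGluing_doubleWith hm hmn).betti_one h.two_mul.pos, h.two_mul.betti_one K]
  simp only [relationDegree_two_mul, doubleWith, Fin.snoc_last]

theorem IsFrobeniusNumber.mem_of_lt {S : AddSubmonoid ℕ} {g : ℤ} (hg : IsFrobeniusNumber S g)
    {m : ℕ} (hm : g < m) : m ∈ S := by
  by_contra h
  exact hm.not_ge (hg.2 fun s hs hsm => h (by rwa [← Nat.cast_injective hsm]))

theorem IsFrobeniusNumber.neg_one_le {S : AddSubmonoid ℕ} {g : ℤ} (hg : IsFrobeniusNumber S g) :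
    -1 ≤ g :=
  hg.2 fun s _ => by omega

end NumSemigroup

/-! ### Comparison of the two semigroups -/

theorem mainTheorem5 (K : Type*) [Field K] {k : ℕ} (n : Fin k → ℕ)
    (hn : NumSemigroup.IsTelescopic n) (g f : ℤ)
    (hg : NumSemigroup.IsFrobeniusNumber (NumSemigroup.semigroup n) g)
    (hf : Odd f) (hfg : 3 * g + 1 ≤ f)
    (T₁ T₂ : Fin (k + 1) → ℕ)
    (hT₁ : T₁ = NumSemigroup.doubleWith n (f - 2 * g).toNat)
    (hT₂ : T₂ = NumSemigroup.doubleWith n (f + 2 - 2 * g).toNat) (j : ℕ) :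
    ((j : ℤ) ≠ 2 * (f - 2 * g) → (j : ℤ) ≠ 2 * (f - 2 * g) + 4 →
      NumSemigroup.betti K T₂ 1 j = NumSemigroup.betti K T₁ 1 j) ∧
    ((j : ℤ) = 2 * (f - 2 * g) →
      NumSemigroup.betti K T₂ 1 j + 1 = NumSemigroup.betti K T₁ 1 j ∧
      (NumSemigroup.betti K T₂ 1 j = 0 ↔
        ∀ i : Fin k, 0 < i.val → (NumSemigroup.relationDegree n i : ℤ) ≠ f - 2 * g)) ∧
    ((j : ℤ) = 2 * (f - 2 * g) + 4 →
      NumSemigroup.betti K T₂ 1 j = NumSemigroup.betti K T₁ 1 j + 1) := by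
  have hg1 := hg.neg_one_le
  have hfree := hn.isFreeSequence
  -- Nonnegativity: `f - 2g ≥ g + 1 ≥ 0`, as `g ≥ -1`.
  obtain ⟨m, hm⟩ : ∃ m : ℕ, f - 2 * g = m := ⟨(f - 2 * g).toNat, by omega⟩
  have hm2 : f + 2 - 2 * g = (m + 2 : ℕ) := by omega
  have hodd : Odd m := by
    obtain ⟨b, hb⟩ := hf
    rw [Nat.odd_iff]
    omega
  rw [hm, Int.toNat_natCast] at hT₁
  rw [hm2, Int.toNat_natCast] at hT₂
  subst hT₁ hT₂
  -- The bound on `f` gives `m ≥ g + 1`, so `m` lies beyond the Frobenius number.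
  have h1 := hfree.betti_one_doubleWith K hodd (hg.mem_of_lt (by omega)) j
  have h2 := hfree.betti_one_doubleWith K (m := m + 2) (hodd.add_even even_two)
    (hg.mem_of_lt (by omega)) j
  rw [hm]
  refine ⟨fun ha hb => ?_, fun ha => ?_, fun ha => ?_⟩
  · rw [if_neg (by omega)] at h1 h2
    omega
  · rw [if_pos (by omega)] at h1
    rw [if_neg (by omega)] at h2
    refine ⟨by omega, ?_⟩
    -- In degree `2 * m` only the common relations count for `T₂`; none has `2 * r_i = 2 * m`
    -- exactly when `m` is no `r_i`.
    rw [h2, add_zero, Finset.sum_eq_zero_iff]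
    refine forall_congr' fun i => ?_
    simp only [Finset.mem_univ, true_imp_iff, ite_eq_right_iff, one_ne_zero, imp_false, not_and]
    refine imp_congr_right fun _ => not_congr ?_
    omega
  · rw [if_neg (by omega)] at h1
    rw [if_pos (by omega)] at h2
    omega
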